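/- **Setting.** Let $H$ be a finite-dimensional (purely even) complex vector space with basis $\{\mathcal O_\alpha\}_{\alpha\in A}$, one element of which is singled out as the puncture operator $P$; write $\mathcal O_\alpha^{(k)}=t^k\mathcal O_\alpha\in H[[t]]$. Let $\langle-\rangle_0:\mathrm{Sym}^\bullet(H[[t]])\to\mathbb C$ be genus zero correlation functions of a 2d topological field theory, that is, a linear map which vanishes on products of fewer than three insertions, for which the matrix $g_{\alpha\beta}=\langle\mathcal O_\alpha\mathcal O_\beta P\rangle_0$ is invertible (inverse $g^{\alpha\beta}$), and which satisfies, for all $i,j,k\ge 0$ and all $\alpha,\beta,\gamma$, the topological recursion relation $$\langle\langle\mathcal O^{(i+1)}_\alpha\mathcal O^{(j)}_\beta\mathcal O^{(k)}_\gamma\rangle\rangle_0=\sum_{\sigma,\tau}g^{\sigma\tau}\,\langle\langle\mathcal O^{(i)}_\alpha\mathcal O^{(0)}_\tau\rangle\rangle_0\,\langle\langle\mathcal O^{(0)}_\sigma\mathcal O^{(j)}_\beta\mathcal O^{(k)}_\gamma\rangle\rangle_0,\qquad \langle\langle x\rangle\rangle_0:=\Big\langle x\,\exp\Big(\sum_{k,\alpha}b^\alpha_k\mathcal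 O_\alpha^{(k)}\Big)\Big\rangle_0\in\mathbb C[[b^\alpha_k]].$$ **Current observables.** Consider fields $\mu=\sum_{k,\alpha}(\lambda^\alpha_k+\rho^\alpha_k\partial_z)\otimes\mathcal O_\alpha t^k$ on $\mathbb C^\times=\mathbb C/(z\sim z+1)$, with $\lambda^\alpha_k,\rho^\alpha_k\in\Omega^{0,\bullet}(\mathbb C^\times)$ (as symbols, $\lambda$ is even and $\rho$ is odd). For $\mathcal L\in\mathbb C[[\partial_z^m\lambda^\alpha_k,\partial_z^m\rho^\alpha_k]]$ let $\mathscr J_{\mathcal L}=dz\,\mathcal L$, and let $\mathscr J^{(1)}_{\mathcal L}$, $\mathscr J^{(2)}_{\mathcal L}$ be its $1$-form and $2$-form parts, obtained by expanding $\lambda^\alpha_k$, $\rho^\alpha_k$ in their $(0,0)$- and $(0,1)$-components. Let $C=\{z\in[0,1]\}$. The integrals $\oint_C$ and $\int_{\mathbb C^\times}$ are understood formally: $\oint_C dz\,f$ denotes the class of the density $f$, a formal power series in the jets of the component fields, modulo total $\partial_z$-derivatives. The bracket on observables $\oint_C\mathscr J^{(1)}_{\mathcal L}$ is $$\Big\{\oint_C\mathscr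 J^{(1)}_{\mathcal L_1},\oint_C\mathscr J^{(1)}_{\mathcal L_2}\Big\}_C:=\Big\{\int_{\mathbb C^\times}\mathscr J^{(2)}_{\mathcal L_1},\oint_C\mathscr J^{(1)}_{\mathcal L_2}\Big\}_{\mathrm{BV}},$$ where $\{S,-\}_{\mathrm{BV}}$ is the action of the Hamiltonian vector field of $S$ for the BV kernel $K_0=\sum_{\alpha,\beta}g^{\alpha\beta}\,\mathcal O_\alpha\otimes\mathcal O_\beta\;\partial_z\delta(z-w)\,(d\bar z-d\bar w)$. **Proposition.** Let $$\mathcal G_{k,\alpha}:=\Big\langle\mathcal O^{(k)}_\alpha\exp\Big(\sum_\beta\lambda^\beta_0\mathcal O_\beta\Big)\Big\rangle_0\in\mathbb C[[\lambda^\beta_0]].$$ Then for all $k,m\ge 0$ and all $\alpha,\beta$ $$\Big\{\oint_C\mathscr J^{(1)}_{\mathcal G_{k,\alpha}},\oint_C\mathscr J^{(1)}_{\mathcal G_{m,\beta}}\Big\}_C=0 ,$$ and this holds whichever densities $\mathcal L_1,\mathcal L_2$ with $\oint_C\mathscr J^{(1)}_{\mathcal L_1}=\oint_C\mathscr J^{(1)}_{\mathcal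 G_{k,\alpha}}$ and $\oint_C\mathscr J^{(1)}_{\mathcal L_2}=\oint_C\mathscr J^{(1)}_{\mathcal G_{m,\beta}}$ are used to compute the bracket. -/

import Mathlib

noncomputable section

/-! ## Formal power series in commuting and anticommuting variables -/

/-- Formal power series over `ℂ` in even (commuting) variables `x v`, `v : σ`, and odd
(anticommuting) variables `θ w`, `w : τ`, given by their coefficients: `f (n, S)` is the coefficient
of `x ^ n * θ_S`, where `θ_S` is the product of the `θ w`, `w ∈ S`, in increasing order for a fixed
well-order of `τ`. -/
def SuperSeries (σ τ : Type*) : Type _ := (σ →₀ ℕ) × Finset τ → ℂ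

namespace SuperSeries

variable {σ τ : Type*}

instance : AddCommGroup (SuperSeries σ τ) :=
  inferInstanceAs (AddCommGroup ((σ →₀ ℕ) × Finset τ → ℂ))

instance : Module ℂ (SuperSeries σ τ) :=
  inferInstanceAs (Module ℂ ((σ →₀ ℕ) × Finset τ → ℂ))

open Classical in
/-- The sign of reordering: `θ_T * θ_U = sign T U • θ_(T ∪ U)` for disjoint `T`, `U`. -/
def sign (T U : Finset τ) : ℂ :=
  (-1) ^ ((T ×ˢ U).filter fun p => WellOrderingRel p.2 p.1).card

open Classical in
/-- The graded commutative product. -/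
instance : Mul (SuperSeries σ τ) where
  mul f g := fun a => ∑ p ∈ Finset.HasAntidiagonal.antidiagonal a.1, ∑ T ∈ a.2.powerset,
    sign T (a.2 \ T) * f (p.1, T) * g (p.2, a.2 \ T)

open Classical in
/-- The even variable `x v`. -/
def even (v : σ) : SuperSeries σ τ := fun a => if a = (Finsupp.single v 1, ∅) then 1 else 0

open Classical in
/-- The odd variable `θ w`. -/
def odd (w : τ) : SuperSeries σ τ := fun a => if a = (0, {w}) then 1 else 0

open Classical in
/-- The partial derivative with respect to the even variable `x v`. -/
def evenDeriv (v : σ) (f : SuperSeries σ τ) : SuperSeries σ τ :=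
  fun a => (a.1 v + 1) * f (a.1 + Finsupp.single v 1, a.2)

open Classical in
/-- The left partial derivative with respect to the odd variable `θ w`. -/
def oddDeriv (w : τ) (f : SuperSeries σ τ) : SuperSeries σ τ :=
  fun a => if w ∈ a.2 then 0 else sign {w} a.2 * f (a.1, insert w a.2)

/-- The parity involution: `1` on even and `-1` on odd elements. -/
def parity (f : SuperSeries σ τ) : SuperSeries σ τ := fun a => (-1) ^ a.2.card * f a

/-- The sum of a family of series in which every monomial occurs only finitely often. -/
def formalSum {κ : Type*} (f : κ → SuperSeries σ τ) : SuperSeries σ τ := fun a => ∑ᶠ i, f i a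

/-- The derivation that takes the prescribed values `ξ v` on the variables `x v` and `η w` on the
variables `θ w`. -/
def derivation (ξ : σ → SuperSeries σ τ) (η : τ → SuperSeries σ τ) (f : SuperSeries σ τ) :
    SuperSeries σ τ :=
  formalSum (fun v => ξ v * evenDeriv v f) + formalSum (fun w => η w * oddDeriv w f)

end SuperSeries

/-! ## Fields of the `H`-valued BCOV theory on `ℂˣ` and their jets -/

/-- The even component fields. A field is `∑ λ^α_k ⊗ O_α t^k + ρ^α_k ∂_z ⊗ O_α t^k` with
`λ^α_k, ρ^α_k ∈ Ω^{0,•}(ℂˣ)`; here `λ^α_k = lam0 k α + dz̄ * lam1 k α` and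
`ρ^α_k = rho0 k α + dz̄ * rho1 k α`. -/
inductive EvenField (ι : Type*) where
  | lam0 (k : ℕ) (α : ι)
  | rho1 (k : ℕ) (α : ι)

/-- The odd component fields. -/
inductive OddField (ι : Type*) where
  | lam1 (k : ℕ) (α : ι)
  | rho0 (k : ℕ) (α : ι)

/-- Formal power series in the holomorphic jets of the component fields: the variable `(φ, m)`
stands for `∂_z^m φ`. Neither the currents nor the BV kernel involve `∂_z̄`. -/
abbrev FieldSeries (ι : Type*) := SuperSeries (EvenField ι × ℕ) (OddField ι × ℕ)

namespace FieldSeries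

open SuperSeries EvenField OddField

variable {ι : Type*}

/-- The total derivative `∂_z`. -/
def totalDeriv : FieldSeries ι → FieldSeries ι :=
  derivation (fun v => even (v.1, v.2 + 1)) (fun w => odd (w.1, w.2 + 1))

/-- Variational derivative `∑ₘ (-∂_z)^m ∂f/∂(∂_z^m φ)` with respect to an even field `φ`. -/
def varEven (φ : EvenField ι) (f : FieldSeries ι) : FieldSeries ι :=
  formalSum fun m : ℕ => (fun h => -totalDeriv h)^[m] (evenDeriv (φ, m) f)

/-- Variational (left) derivative with respect to an odd field `φ`. -/
def varOdd (φ : OddField ι) (f : FieldSeries ι) : FieldSeries ι :=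
  formalSum fun m : ℕ => (fun h => -totalDeriv h)^[m] (oddDeriv (φ, m) f)

/-- Total `∂_z`-derivatives. -/
def totalDerivatives (ι : Type*) : Submodule ℂ (FieldSeries ι) :=
  Submodule.span ℂ (Set.range totalDeriv)

/-- Observables `∮_C dz f` supported on the circle `C = {z ∈ [0,1]}` in `ℂˣ = ℂ/ℤ`: densities `f`
modulo total derivatives. -/
abbrev CircleObservable (ι : Type*) := FieldSeries ι ⧸ totalDerivatives ι

/-- The observable `∮_C dz f`. -/
def circleInt (f : FieldSeries ι) : CircleObservable ι := Submodule.Quotient.mk f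

/-- The formal differential ring `ℂ⟦∂_z^m λ^α_k, ∂_z^m ρ^α_k⟧`, with the symbols `λ^α_k`, `ρ^α_k`
written as `lam0 k α`, `rho0 k α`. -/
def Density (ι : Type*) : Submodule ℂ (FieldSeries ι) where
  carrier := {L | ∀ a, L a ≠ 0 →
    (∀ v ∈ a.1.support, ∃ k α, v.1 = lam0 k α) ∧ (∀ w ∈ a.2, ∃ k α, w.1 = rho0 k α)}
  zero_mem' := fun _ h => (h rfl).elim
  add_mem' := by
    intro f g hf hg a h
    by_cases h0 : f a = 0
    · refine hg a fun h1 => h ?_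
      change f a + g a = 0
      rw [h0, h1, add_zero]
    · exact hf a h0
  smul_mem' := by
    intro c f hf a h
    refine hf a fun h0 => h ?_
    change c * f a = 0
    rw [h0, mul_zero]

/-- The coefficient of `dz` in `𝒥_L^{(1)}`, the `1`-form part of `𝒥_L = dz L(λ, ρ)`. -/
def currentOne (L : Density ι) : FieldSeries ι := L

/-- The coefficient of `dz ∧ dz̄` in `𝒥_L^{(2)}`: as `dz̄ ^ 2 = 0`, substituting
`lam0 + dz̄ * lam1` and `rho0 + dz̄ * rho1` for the symbols of `L` gives `L + dz̄ * D L` where `D` is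
the derivation `lam0 ↦ lam1`, `rho0 ↦ rho1`. -/
def currentTwo (L : Density ι) : FieldSeries ι :=
  derivation
    (fun v => match v with
      | (lam0 k α, m) => odd (lam1 k α, m)
      | (rho1 _ _, _) => 0)
    (fun w => match w with
      | (rho0 k α, m) => even (rho1 k α, m)
      | (lam1 _ _, _) => 0)
    L

variable [Fintype ι]

/-- The Hamiltonian vector field `{S, -}_BV` of the local functional `S = ∫_{ℂˣ} dz ∧ dz̄ s`, for the
BV kernel `∑ g^{αβ} O_α ⊗ O_β ∂_z δ(z - w) (dz̄ - dw̄)`, which only pairs the two components of the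
`λ^α_0`. It is the derivation that commutes with `∂_z` and has
`lam0 0 α ↦ -∑ g^{αβ} ∂_z (δS/δ lam1 0 β)`, `lam1 0 α ↦ (-1)^{|S|} ∑ g^{αβ} ∂_z (δS/δ lam0 0 β)`;
it is zero on the other fields. -/
def hamiltonianField (ginv : Matrix ι ι ℂ) (s : FieldSeries ι) :
    FieldSeries ι → FieldSeries ι :=
  derivation
    (fun v => match v with
      | (lam0 0 α, m) => totalDeriv^[m] (-∑ β, ginv α β • totalDeriv (varOdd (lam1 0 β) s))
      | _ => 0)
    (fun w => match w with
      | (lam1 0 α, m) => totalDeriv^[m] (∑ β, ginv α β • totalDeriv (varEven (lam0 0 β) (parity s)))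
      | _ => 0)

/-- The BV bracket `{∫_{ℂˣ} dz ∧ dz̄ s, ∮_C dz f}_BV`. -/
def bvBracket (ginv : Matrix ι ι ℂ) (s f : FieldSeries ι) : CircleObservable ι :=
  circleInt (hamiltonianField ginv s f)

/-- The bracket
`{∮_C 𝒥_{L₁}^{(1)}, ∮_C 𝒥_{L₂}^{(1)}}_C = {∫_{ℂˣ} 𝒥_{L₁}^{(2)}, ∮_C 𝒥_{L₂}^{(1)}}_BV`. -/
def currentBracket (ginv : Matrix ι ι ℂ) (L₁ L₂ : Density ι) : CircleObservable ι :=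
  bvBracket ginv (currentTwo L₁) (currentOne L₂)

end FieldSeries

/-! ## Genus zero correlation functions -/

/-- A (purely even) small phase space `H` with basis `O_α` and puncture operator `P`, and a
correlation function `⟨-⟩₀ : Sym(H⟦t⟧) → ℂ`. An element `∑ hₖ t^k` of the big phase space `H⟦t⟧` is
the sequence `k ↦ hₖ`. -/
structure CorrelationData (ι H : Type*) [AddCommGroup H] [Module ℂ H] where
  basis : Module.Basis ι ℂ H
  puncture : ι
  corr : SymmetricAlgebra ℂ (ℕ → H) →ₗ[ℂ] ℂ

namespace CorrelationData

variable {ι H : Type*} [Fintype ι] [AddCommGroup H] [Module ℂ H] (T : CorrelationData ι H)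

/-- The insertion `O_α^{(k)} = t^k O_α`. -/
def insertion (k : ℕ) (α : ι) : SymmetricAlgebra ℂ (ℕ → H) :=
  SymmetricAlgebra.ι ℂ (ℕ → H) (Pi.single k (T.basis α))

/-- The metric `g_{αβ} = ⟨O_α O_β P⟩₀`. -/
def metric : Matrix ι ι ℂ :=
  Matrix.of fun α β => T.corr (T.insertion 0 α * T.insertion 0 β * T.insertion 0 T.puncture)

open Classical in
/-- The inverse matrix `g^{αβ}`. -/
def metricInv : Matrix ι ι ℂ := T.metric⁻¹

/-- The insertion `O^{(k)α} = ∑_β g^{αβ} O_β^{(k)}`. -/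
def raisedInsertion (k : ℕ) (α : ι) : SymmetricAlgebra ℂ (ℕ → H) :=
  ∑ β, T.metricInv α β • T.insertion k β

/-- The power series `⟨x exp(∑_v s_v u_v)⟩₀` in the variables `s_v`, `v : κ`. -/
def expCorr {κ : Type*} (u : κ → SymmetricAlgebra ℂ (ℕ → H)) (x : SymmetricAlgebra ℂ (ℕ → H)) :
    MvPowerSeries κ ℂ :=
  fun n => T.corr (x * n.prod fun v e => u v ^ e) / (n.prod fun _ e => (e.factorial : ℂ))

/-- `⟪x⟫₀(𝐛) = ⟨x exp(∑ b^α_k O_α^{(k)})⟩₀`, a power series in the `b^α_k`. -/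
def bigCorr (x : SymmetricAlgebra ℂ (ℕ → H)) : MvPowerSeries (ℕ × ι) ℂ :=
  T.expCorr (fun v => T.insertion v.1 v.2) x

open Classical in
/-- Genus zero correlation functions of a 2d topological field theory: at least three insertions
are needed, the metric is non-degenerate, and the topological recursion relation holds. -/
structure IsGenusZero : Prop where
  stable : ∀ (n : ℕ) (x : Fin n → ℕ → H), n < 3 →
    T.corr (∏ i, SymmetricAlgebra.ι ℂ (ℕ → H) (x i)) = 0
  nondegenerate : T.metric.det ≠ 0
  recursion : ∀ (i j k : ℕ) (α β γ : ι),
    T.bigCorr (T.insertion (i + 1) α * T.insertion j β * T.insertion k γ) =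
      ∑ σ, T.bigCorr (T.insertion i α * T.raisedInsertion 0 σ) *
        T.bigCorr (T.insertion 0 σ * T.insertion j β * T.insertion k γ)

open FieldSeries EvenField

open Classical in
/-- A power series in variables indexed by `ι`, read as a density in the `λ^α_0`. -/
def toDensity (f : MvPowerSeries ι ℂ) : Density ι :=
  ⟨fun a => if a.2 = ∅ ∧ ∀ v ∈ a.1.support, ∃ β, v = (lam0 0 β, 0) then
      MvPowerSeries.coeff (Finsupp.equivFunOnFinite.symm fun β => a.1 (lam0 0 β, 0)) f
    else 0, by
    intro a ha
    dsimp only at ha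
    split_ifs at ha with h
    · refine ⟨fun v hv => ?_, fun w hw => ?_⟩
      · obtain ⟨β, rfl⟩ := h.2 v hv
        exact ⟨0, β, rfl⟩
      · rw [h.1] at hw
        exact absurd hw (Finset.notMem_empty w)
    · exact absurd rfl ha⟩

/-- `𝒢_{k,α} = ⟨O_α^{(k)} exp(∑ λ^β_0 O_β)⟩₀ ∈ ℂ⟦λ^β_0⟧`. -/
def hamiltonianDensity (k : ℕ) (α : ι) : Density ι :=
  toDensity (T.expCorr (T.insertion 0) (T.insertion k α))

end CorrelationData

end

/-! Write `f₁`, `f₂` for the two small phase space series. They involve no derivatives, so the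
variational derivative of `f₁` is its gradient, and the Hamiltonian vector field is evolutionary:
`λ^σ_0 ↦ -∑ g^{στ} ∂_z(∂_τ f₁)`. Applied to `f₂` it gives, by the chain rule, `-∑_γ (∂_z λ^γ_0) ∑
g^{στ} (∂_γ ∂_τ f₁)(∂_σ f₂)`. This is a total derivative as soon as the inner sum is a gradient `∂_γ
w`.

The topological recursion relation supplies `w`. With its third insertion at level zero and its
variables restricted to the small phase space, it says exactly that `w = ⟨O_β^{(m+1)} O_α^{(k)}
exp(∑ λ_0 O)⟩₀` is such a potential (`pderiv_small_two_point`), because differentiating in `λ^γ_0`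
inserts `O_γ` (`pderiv_expCorr`).

Independence of representatives rests on two facts of the variational calculus. The Euler operator
kills total derivatives (`varEven_totalDeriv`), so the vector field depends only on the class of the
first density; here `varOdd_currentTwo` reduces the 2-form current to the density itself. An
evolutionary field commutes with `∂_z` (`totalDeriv_evenField`), so changing the second density by a
total derivative changes the result by one.

All sums over jet variables are infinite. They are controlled by two devices: operators whose output
coefficients depend on finitely many input coefficients commute with locally finite sums, and `∂_z`
raises the number of derivatives in a monomial, which makes the relevant sums locally finite. -/

noncomputable section

/-! ### Coefficientwise calculus of super power series -/

namespace SuperSeries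

open MvPowerSeries

variable {σ τ κ : Type*}

@[ext] theorem ext {f g : SuperSeries σ τ} (h : ∀ a, f a = g a) : f = g := funext h

@[simp] theorem add_apply (f g : SuperSeries σ τ) (a) : (f + g) a = f a + g a := rfl

@[simp] theorem neg_apply (f : SuperSeries σ τ) (a) : (-f) a = -f a := rfl

@[simp] theorem sub_apply (f g : SuperSeries σ τ) (a) : (f - g) a = f a - g a := rfl

@[simp] theorem zero_apply (a) : (0 : SuperSeries σ τ) a = 0 := rfl

@[simp] theorem smul_coeff (c : ℂ) (f : SuperSeries σ τ) (a) : (c • f) a = c * f a := rfl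

/-- Evaluation of the coefficient at `a`, as a linear form. -/
def coeffHom (a : (σ →₀ ℕ) × Finset τ) : SuperSeries σ τ →ₗ[ℂ] ℂ where
  toFun f := f a
  map_add' _ _ := rfl
  map_smul' _ _ := rfl

@[simp] theorem sum_apply (s : Finset κ) (f : κ → SuperSeries σ τ) (a) :
    (∑ i ∈ s, f i) a = ∑ i ∈ s, f i a :=
  map_sum (coeffHom a) f s

open Classical in
theorem mul_coeff (f g : SuperSeries σ τ) (a) : (f * g) a =
    ∑ p ∈ Finset.HasAntidiagonal.antidiagonal a.1, ∑ T ∈ a.2.powerset,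
      sign T (a.2 \ T) * f (p.1, T) * g (p.2, a.2 \ T) := rfl

/-- Distributivity suffices as general ring structure. Products are regrouped or reordered only past
purely even factors, where no reordering signs appear; `ofEven_mul_mul` and `odd_mul_ofEven_mul`
handle those cases. -/
instance : NonUnitalNonAssocSemiring (SuperSeries σ τ) where
  left_distrib f g h := by
    ext a
    simp only [mul_coeff, add_apply, mul_add, Finset.sum_add_distrib]
  right_distrib f g h := by
    ext a
    simp only [mul_coeff, add_apply, mul_add, add_mul, Finset.sum_add_distrib]
  zero_mul f := by ext a; simp [mul_coeff]
  mul_zero f := by ext a; simp [mul_coeff]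

/-- The coefficient of `θ_S`. -/
def part (S : Finset τ) (f : SuperSeries σ τ) : MvPowerSeries σ ℂ := fun n => f (n, S)

@[simp] theorem coeff_part (S : Finset τ) (f : SuperSeries σ τ) (n) :
    coeff n (part S f) = f (n, S) := rfl

theorem ext_part {f g : SuperSeries σ τ} (h : ∀ S, part S f = part S g) : f = g :=
  ext fun a => congrFun (h a.2) a.1

open Classical in
/-- A power series in the even variables. -/
def ofEven (P : MvPowerSeries σ ℂ) : SuperSeries σ τ :=
  fun a => if a.2 = ∅ then coeff a.1 P else 0

theorem ofEven_apply_empty (P : MvPowerSeries σ ℂ) (n) :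
    (ofEven P : SuperSeries σ τ) (n, ∅) = coeff n P := if_pos rfl

theorem ofEven_apply_of_ne (P : MvPowerSeries σ ℂ) {a : (σ →₀ ℕ) × Finset τ} (h : a.2 ≠ ∅) :
    (ofEven P : SuperSeries σ τ) a = 0 := if_neg h

theorem part_ofEven_empty (P : MvPowerSeries σ ℂ) :
    part ∅ (ofEven P : SuperSeries σ τ) = P :=
  funext fun n => ofEven_apply_empty P n

theorem part_ofEven_of_ne (P : MvPowerSeries σ ℂ) {S : Finset τ} (h : S ≠ ∅) :
    part S (ofEven P : SuperSeries σ τ) = 0 :=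
  funext fun _ => if_neg h

theorem ofEven_smul (c : ℂ) (P : MvPowerSeries σ ℂ) :
    (ofEven (c • P) : SuperSeries σ τ) = c • ofEven P := by
  ext a
  by_cases h : a.2 = ∅ <;> simp [ofEven, h]

theorem ofEven_neg (P : MvPowerSeries σ ℂ) : (ofEven (-P) : SuperSeries σ τ) = -ofEven P := by
  ext a
  by_cases h : a.2 = ∅ <;> simp [ofEven, h]

theorem ofEven_sum (s : Finset κ) (P : κ → MvPowerSeries σ ℂ) :
    (ofEven (∑ i ∈ s, P i) : SuperSeries σ τ) = ∑ i ∈ s, ofEven (P i) := by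
  ext a
  by_cases h : a.2 = ∅ <;> simp [ofEven, h]

theorem even_eq_ofEven (v : σ) : (even v : SuperSeries σ τ) = ofEven (X v) := by
  classical
  ext ⟨n, S⟩
  by_cases h : S = ∅ <;> simp [even, ofEven, h, coeff_X]

@[simp] theorem sign_empty_left (S : Finset τ) : sign ∅ S = 1 := by simp [sign]

@[simp] theorem sign_mul_self (S T : Finset τ) : sign S T * sign S T = 1 := by
  rw [sign, ← mul_pow]; simp

/-- Only the splitting with `T = ∅` contributes, and its sign is `1`. Each odd component is thus a
module over the even series, which reduces many identities to `MvPowerSeries`. -/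
theorem part_ofEven_mul (P : MvPowerSeries σ ℂ) (g : SuperSeries σ τ) (S : Finset τ) :
    part S (ofEven P * g) = P * part S g := by
  classical
  ext n
  rw [coeff_part, mul_coeff, coeff_mul]
  have H : ∀ p : (σ →₀ ℕ) × (σ →₀ ℕ), ∑ T ∈ S.powerset,
      sign T (S \ T) * (ofEven P : SuperSeries σ τ) (p.1, T) * g (p.2, S \ T) =
      coeff p.1 P * coeff p.2 (part S g) := by
    intro p
    rw [Finset.sum_eq_single ∅]
    · simp [ofEven_apply_empty]
    · intro T _ hT
      rw [ofEven_apply_of_ne P hT]; simp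
    · simp
  simp only [H]

theorem ofEven_mul (P Q : MvPowerSeries σ ℂ) :
    (ofEven (P * Q) : SuperSeries σ τ) = ofEven P * ofEven Q := by
  refine ext_part fun S => ?_
  rw [part_ofEven_mul]
  by_cases h : S = ∅
  · subst h; simp only [part_ofEven_empty]
  · simp only [part_ofEven_of_ne _ h, mul_zero]

theorem ofEven_mul_mul (P Q : MvPowerSeries σ ℂ) (g : SuperSeries σ τ) :
    ofEven P * (ofEven Q * g) = ofEven (P * Q) * g := by
  refine ext_part fun S => ?_
  simp only [part_ofEven_mul, mul_assoc]

theorem part_evenDeriv (v : σ) (f : SuperSeries σ τ) (S : Finset τ) :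
    part S (evenDeriv v f) = pderiv ℂ v (part S f) := by
  ext n
  rw [coeff_pderiv, coeff_part, coeff_part, evenDeriv, mul_comm]

theorem evenDeriv_ofEven (v : σ) (P : MvPowerSeries σ ℂ) :
    evenDeriv v (ofEven P : SuperSeries σ τ) = ofEven (pderiv ℂ v P) := by
  refine ext_part fun S => ?_
  rw [part_evenDeriv]
  by_cases h : S = ∅
  · subst h; simp only [part_ofEven_empty]
  · simp only [part_ofEven_of_ne _ h, map_zero]

theorem evenDeriv_ofEven_mul (v : σ) (P : MvPowerSeries σ ℂ) (g : SuperSeries σ τ) :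
    evenDeriv v (ofEven P * g) = ofEven (pderiv ℂ v P) * g + ofEven P * evenDeriv v g := by
  refine ext_part fun S => ?_
  change _ = part S _ + part S _
  simp only [part_evenDeriv, part_ofEven_mul, Derivation.leibniz, smul_eq_mul]
  ring

theorem pderiv_comm (u v : σ) (P : MvPowerSeries σ ℂ) :
    pderiv ℂ u (pderiv ℂ v P) = pderiv ℂ v (pderiv ℂ u P) := by
  classical
  ext n
  simp only [coeff_pderiv, add_right_comm n (Finsupp.single u 1), Finsupp.add_apply]
  rcases eq_or_ne u v with rfl | h
  · rfl
  · simp only [Finsupp.single_eq_of_ne h, Finsupp.single_eq_of_ne h.symm]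
    push_cast
    ring

theorem evenDeriv_comm (u v : σ) (f : SuperSeries σ τ) :
    evenDeriv u (evenDeriv v f) = evenDeriv v (evenDeriv u f) :=
  ext_part fun S => by simp only [part_evenDeriv, pderiv_comm u v]

theorem evenDeriv_oddDeriv (v : σ) (w : τ) (f : SuperSeries σ τ) :
    evenDeriv v (oddDeriv w f) = oddDeriv w (evenDeriv v f) := by
  ext a
  by_cases h : w ∈ a.2
  · simp [evenDeriv, oddDeriv, h]
  · simp only [evenDeriv, oddDeriv, if_neg h]
    ring

open Classical in
theorem odd_mul_apply (w : τ) (g : SuperSeries σ τ) (n : σ →₀ ℕ) (S : Finset τ) :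
    (odd w * g : SuperSeries σ τ) (n, S) = if w ∈ S then sign {w} (S.erase w) * g (n, S.erase w) else 0 := by
  rw [mul_coeff, Finset.sum_eq_single (0, n)]
  · dsimp only
    split_ifs with h
    · rw [Finset.sum_eq_single {w}]
      · simp [odd, Finset.sdiff_singleton_eq_erase]
      · intro T _ hT
        simp [odd, hT]
      · simp [h]
    · refine Finset.sum_eq_zero fun T hT => ?_
      have : T ≠ {w} := by
        rintro rfl
        simp [h] at hT
      simp [odd, this]
  · rintro ⟨p, q⟩ hp hne
    have : p ≠ 0 := by
      rintro rfl
      simp at hp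
      exact hne (by rw [hp])
    simp [odd, this]
  · simp

theorem evenDeriv_odd_mul (v : σ) (w : τ) (g : SuperSeries σ τ) :
    evenDeriv v (odd w * g) = odd w * evenDeriv v g := by
  classical
  ext ⟨n, S⟩
  rw [odd_mul_apply, evenDeriv, odd_mul_apply]
  split_ifs <;> simp only [evenDeriv] <;> ring

theorem oddDeriv_ofEven (w : τ) (P : MvPowerSeries σ ℂ) :
    oddDeriv w (ofEven P : SuperSeries σ τ) = 0 := by
  ext a
  simp [oddDeriv, ofEven]

theorem oddDeriv_ofEven_mul (w : τ) (P : MvPowerSeries σ ℂ) (g : SuperSeries σ τ) :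
    oddDeriv w (ofEven P * g) = ofEven P * oddDeriv w g := by
  classical
  have H : ∀ (g : SuperSeries σ τ) S, part S (oddDeriv w g) =
      if w ∈ S then 0 else sign {w} S • part (insert w S) g := by
    intro g S
    ext n
    rw [coeff_part, oddDeriv]
    split_ifs <;> simp
  refine ext_part fun S => ?_
  rw [H, part_ofEven_mul, part_ofEven_mul, H]
  split_ifs <;> simp

theorem odd_mul_ofEven_mul (w : τ) (P : MvPowerSeries σ ℂ) (g : SuperSeries σ τ) :
    odd w * (ofEven P * g) = ofEven P * (odd w * g) := by
  classical
  have H : ∀ (g : SuperSeries σ τ) S, part S (odd w * g) =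
      if w ∈ S then sign {w} (S.erase w) • part (S.erase w) g else 0 := by
    intro g S
    ext n
    rw [coeff_part, odd_mul_apply]
    split_ifs <;> simp
  refine ext_part fun S => ?_
  rw [H, part_ofEven_mul, part_ofEven_mul, H]
  split_ifs <;> simp

/-! ### Supports of products and derivatives -/

theorem even_mul_apply_of_eq_zero {v : σ} (g : SuperSeries σ τ) {n : σ →₀ ℕ} (S : Finset τ)
    (h : n v = 0) : (even v * g : SuperSeries σ τ) (n, S) = 0 := by
  classical
  rw [even_eq_ofEven]
  refine (congrArg (coeff _) (part_ofEven_mul (X v) g S)).trans ?_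
  rw [coeff_mul]
  refine Finset.sum_eq_zero fun p hp => ?_
  rw [coeff_X, if_neg, zero_mul]
  rintro h1
  have := DFunLike.congr_fun (Finset.HasAntidiagonal.mem_antidiagonal.mp hp) v
  simp [h1, h] at this

theorem even_mul_apply_add (v : σ) (g : SuperSeries σ τ) (n : σ →₀ ℕ) (S : Finset τ) :
    (even v * g : SuperSeries σ τ) (n + Finsupp.single v 1, S) = g (n, S) := by
  rw [even_eq_ofEven]
  refine (congrArg (coeff _) (part_ofEven_mul (X v) g S)).trans ?_
  rw [mul_comm, X, coeff_add_mul_monomial]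
  simp

theorem mul_apply_eq_zero {f : SuperSeries σ τ} (g : SuperSeries σ τ) {n : σ →₀ ℕ} {S : Finset τ}
    (hf : ∀ p q T, p + q = n → T ⊆ S → f (p, T) = 0) : (f * g : SuperSeries σ τ) (n, S) = 0 := by
  classical
  rw [mul_coeff]
  refine Finset.sum_eq_zero fun p hp => Finset.sum_eq_zero fun T hT => ?_
  rw [hf _ _ _ (Finset.HasAntidiagonal.mem_antidiagonal.mp hp) (Finset.mem_powerset.mp hT),
    mul_zero, zero_mul]

theorem even_mul_apply_eq_zero (v : σ) {g : SuperSeries σ τ} (n : σ →₀ ℕ) {S : Finset τ}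
    (hg : ∀ p, g (p, S) = 0) : (even v * g : SuperSeries σ τ) (n, S) = 0 := by
  rw [even_eq_ofEven]
  refine (congrArg (coeff n) (part_ofEven_mul _ _ _)).trans ?_
  rw [show part S g = 0 from funext hg, mul_zero, map_zero]

open Classical in
theorem odd_mul_apply_eq_zero {w w' : τ} (hw : w ≠ w') {g : SuperSeries σ τ}
    (hg : ∀ p T, w ∈ T → g (p, T) = 0) (n : σ →₀ ℕ) {S : Finset τ} (hS : w ∈ S) :
    (odd w' * g : SuperSeries σ τ) (n, S) = 0 := by
  rw [odd_mul_apply]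
  split_ifs
  · rw [hg _ _ (Finset.mem_erase.mpr ⟨hw, hS⟩), mul_zero]
  · rfl

open Classical in
theorem odd_mul_apply_insert {w : τ} (g : SuperSeries σ τ) (n : σ →₀ ℕ) {S : Finset τ}
    (hS : w ∉ S) : (odd w * g : SuperSeries σ τ) (n, insert w S) = sign {w} S * g (n, S) := by
  rw [odd_mul_apply, if_pos (Finset.mem_insert_self _ _), Finset.erase_insert hS]

open Classical in
theorem oddDeriv_apply_eq_zero {w : τ} (w' : τ) {f : SuperSeries σ τ}
    (hf : ∀ p T, w ∈ T → f (p, T) = 0) (n : σ →₀ ℕ) {S : Finset τ} (hS : w ∈ S) :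
    oddDeriv w' f (n, S) = 0 := by
  rw [oddDeriv]
  split_ifs
  · rfl
  · rw [hf _ _ (Finset.mem_insert_of_mem hS), mul_zero]

theorem oddDeriv_eq_zero {w : τ} {f : SuperSeries σ τ} (hf : ∀ p T, w ∈ T → f (p, T) = 0) :
    oddDeriv w f = 0 := by
  classical
  ext a
  rw [oddDeriv]
  split_ifs
  · rfl
  · rw [hf _ _ (Finset.mem_insert_self _ _), mul_zero]; rfl

/-! ### Operators with finite rows and locally finite sums -/

/-- Every monomial occurs in only finitely many members of the family. -/
def LocallyFinite (f : κ → SuperSeries σ τ) : Prop := ∀ a, (fun i => f i a).HasFiniteSupport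

/-- Linear combinations of finitely many coefficients. -/
def finiteForms (σ τ : Type*) : Submodule ℂ (SuperSeries σ τ → ℂ) :=
  Submodule.span ℂ (Set.range fun a f => f a)

/-- Every coefficient of `Φ f` is a linear combination of finitely many coefficients of `f`. -/
def RowFinite (Φ : SuperSeries σ τ → SuperSeries σ τ) : Prop :=
  ∀ a, (fun f => Φ f a) ∈ finiteForms σ τ

theorem coeff_mem_finiteForms (a : (σ →₀ ℕ) × Finset τ) :
    (fun f : SuperSeries σ τ => f a) ∈ finiteForms σ τ :=
  Submodule.subset_span ⟨a, rfl⟩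

theorem const_mul_mem_finiteForms {ℓ : SuperSeries σ τ → ℂ} (h : ℓ ∈ finiteForms σ τ) (c : ℂ) :
    (fun f => c * ℓ f) ∈ finiteForms σ τ :=
  Submodule.smul_mem _ c h

theorem sum_mem_finiteForms {ℓ : κ → SuperSeries σ τ → ℂ} (s : Finset κ)
    (h : ∀ i ∈ s, ℓ i ∈ finiteForms σ τ) : (fun f => ∑ i ∈ s, ℓ i f) ∈ finiteForms σ τ := by
  have := Submodule.sum_mem _ h
  convert this using 1
  ext f
  simp

/-- The finite support is carried through the induction because `finsum` takes the value zero on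
infinite supports and is additive only on finite ones. -/
theorem map_formalSum_of_mem_finiteForms {ℓ : SuperSeries σ τ → ℂ} (hℓ : ℓ ∈ finiteForms σ τ)
    {f : κ → SuperSeries σ τ} (hf : LocallyFinite f) :
    (fun i => ℓ (f i)).HasFiniteSupport ∧ ℓ (formalSum f) = ∑ᶠ i, ℓ (f i) := by
  induction hℓ using Submodule.span_induction with
  | mem ℓ h =>
    obtain ⟨a, rfl⟩ := h
    exact ⟨hf a, rfl⟩
  | zero => exact ⟨by simp [Function.HasFiniteSupport], by simp⟩
  | add ℓ ℓ' _ _ h h' =>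
    exact ⟨h.1.add h'.1, by
      simp only [Pi.add_apply]
      rw [h.2, h'.2, finsum_add_distrib h.1 h'.1]⟩
  | smul c ℓ _ h =>
    refine ⟨Set.Finite.subset h.1 fun i hi => ?_, ?_⟩
    · simp only [Function.mem_support, Pi.smul_apply, smul_eq_mul] at hi ⊢
      exact right_ne_zero_of_mul hi
    · simp only [Pi.smul_apply, smul_eq_mul]
      rw [h.2, mul_finsum]

theorem RowFinite.locallyFinite {Φ : SuperSeries σ τ → SuperSeries σ τ} (hΦ : RowFinite Φ)
    {f : κ → SuperSeries σ τ} (hf : LocallyFinite f) : LocallyFinite fun i => Φ (f i) :=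
  fun a => (map_formalSum_of_mem_finiteForms (hΦ a) hf).1

theorem RowFinite.map_formalSum {Φ : SuperSeries σ τ → SuperSeries σ τ} (hΦ : RowFinite Φ)
    {f : κ → SuperSeries σ τ} (hf : LocallyFinite f) :
    Φ (formalSum f) = formalSum fun i => Φ (f i) :=
  ext fun a => (map_formalSum_of_mem_finiteForms (hΦ a) hf).2

theorem RowFinite.isLinearMap {Φ : SuperSeries σ τ → SuperSeries σ τ} (hΦ : RowFinite Φ) :
    IsLinearMap ℂ Φ := by
  have H : ∀ ℓ ∈ finiteForms σ τ, IsLinearMap ℂ ℓ := by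
    intro ℓ hℓ
    induction hℓ using Submodule.span_induction with
    | mem ℓ h =>
      obtain ⟨a, rfl⟩ := h
      exact ⟨fun _ _ => rfl, fun _ _ => rfl⟩
    | zero => exact ⟨fun _ _ => by simp, fun _ _ => by simp⟩
    | add ℓ ℓ' _ _ h h' =>
      exact ⟨fun x y => by simp [h.map_add, h'.map_add]; ring,
        fun c x => by simp [h.map_smul, h'.map_smul]; ring⟩
    | smul c ℓ _ h =>
      exact ⟨fun x y => by simp [h.map_add]; ring, fun c x => by simp [h.map_smul]; ring⟩
  exact ⟨fun f g => ext fun a => (H _ (hΦ a)).map_add f g,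
    fun c f => ext fun a => (H _ (hΦ a)).map_smul c f⟩

theorem RowFinite.comp {Φ Ψ : SuperSeries σ τ → SuperSeries σ τ} (hΦ : RowFinite Φ)
    (hΨ : RowFinite Ψ) : RowFinite fun f => Φ (Ψ f) := by
  have H : ∀ ℓ ∈ finiteForms σ τ, (fun f => ℓ (Ψ f)) ∈ finiteForms σ τ := by
    intro ℓ hℓ
    induction hℓ using Submodule.span_induction with
    | mem ℓ h =>
      obtain ⟨a, rfl⟩ := h
      exact hΨ a
    | zero => exact Submodule.zero_mem _
    | add ℓ ℓ' _ _ h h' => exact Submodule.add_mem _ h h'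
    | smul c ℓ _ h => exact Submodule.smul_mem _ c h
  exact fun a => H _ (hΦ a)

theorem RowFinite.add {Φ Ψ : SuperSeries σ τ → SuperSeries σ τ} (hΦ : RowFinite Φ)
    (hΨ : RowFinite Ψ) : RowFinite fun f => Φ f + Ψ f :=
  fun a => Submodule.add_mem _ (hΦ a) (hΨ a)

theorem rowFinite_evenDeriv (v : σ) : RowFinite (evenDeriv v : SuperSeries σ τ → _) :=
  fun _ => const_mul_mem_finiteForms (coeff_mem_finiteForms _) _

theorem rowFinite_oddDeriv (w : τ) : RowFinite (oddDeriv w : SuperSeries σ τ → _) := by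
  intro a
  by_cases h : w ∈ a.2
  · simp only [oddDeriv, if_pos h]
    exact Submodule.zero_mem _
  · simp only [oddDeriv, if_neg h]
    exact const_mul_mem_finiteForms (coeff_mem_finiteForms _) _

theorem rowFinite_mul_left (f : SuperSeries σ τ) : RowFinite fun g => f * g := by
  classical
  intro a
  simp only [mul_coeff]
  exact sum_mem_finiteForms _ fun p _ => sum_mem_finiteForms _ fun T _ =>
    const_mul_mem_finiteForms (coeff_mem_finiteForms _) _

theorem rowFinite_mul_right (g : SuperSeries σ τ) : RowFinite fun f => f * g := by
  classical
  intro a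
  simp only [mul_coeff, mul_right_comm _ _ (g _)]
  exact sum_mem_finiteForms _ fun p _ => sum_mem_finiteForms _ fun T _ =>
    const_mul_mem_finiteForms (coeff_mem_finiteForms _) _

/-- The finiteness is uniform in `f`: a fixed output coefficient sees the same finite set of indices
for every input. -/
theorem rowFinite_formalSum {Φ : κ → SuperSeries σ τ → SuperSeries σ τ} (hΦ : ∀ i, RowFinite (Φ i))
    (hfin : ∀ a, {i | ∃ f, Φ i f a ≠ 0}.Finite) : RowFinite fun f => formalSum fun i => Φ i f := by
  intro a
  have : (fun f => formalSum (fun i => Φ i f) a) = fun f => ∑ i ∈ (hfin a).toFinset, Φ i f a := by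
    ext f
    exact finsum_eq_sum_of_support_subset _ fun i hi => by simpa using ⟨f, hi⟩
  rw [this]
  exact sum_mem_finiteForms _ fun i _ => hΦ i a

theorem formalSum_add {f g : κ → SuperSeries σ τ} (hf : LocallyFinite f) (hg : LocallyFinite g) :
    formalSum (fun i => f i + g i) = formalSum f + formalSum g :=
  ext fun a => finsum_add_distrib (hf a) (hg a)

theorem formalSum_eq_zero {f : κ → SuperSeries σ τ} (h : ∀ i, f i = 0) : formalSum f = 0 :=
  ext fun a => by simp [formalSum, h]

theorem formalSum_eq_single {f : κ → SuperSeries σ τ} (i : κ) (h : ∀ j, j ≠ i → f j = 0) :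
    formalSum f = f i :=
  ext fun a => finsum_eq_single _ i fun j hj => by rw [h j hj]; rfl

theorem formalSum_comp_embedding {κ' : Type*} {e : κ' → κ} (he : Function.Injective e)
    {f : κ → SuperSeries σ τ} (h : ∀ i, i ∉ Set.range e → f i = 0) :
    formalSum (fun j => f (e j)) = formalSum f := by
  ext a
  simp only [formalSum]
  rw [← finsum_mem_range (f := fun i => f i a) he, ← finsum_mem_univ fun i => f i a]
  refine finsum_mem_inter_support_eq' (fun i => f i a) _ _ fun i hi => iff_of_true ?_ trivial
  by_contra hc
  exact hi (congrArg (coeffHom a) (h i hc))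

theorem formalSum_eq_sum_comp [Fintype κ] {κ' : Type*} {e : κ → κ'} (he : Function.Injective e)
    {f : κ' → SuperSeries σ τ} (h : ∀ i, i ∉ Set.range e → f i = 0) :
    formalSum f = ∑ j, f (e j) := by
  rw [← formalSum_comp_embedding he h]
  ext a
  simp [formalSum, finsum_eq_sum_of_fintype]

end SuperSeries

/-! ### The total derivative on jets -/

namespace FieldSeries

open SuperSeries EvenField OddField MvPowerSeries

variable {ι : Type*}

/-- The even jet variable `∂_z v`. -/
def evenSucc (v : EvenField ι × ℕ) : EvenField ι × ℕ := (v.1, v.2 + 1)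

theorem evenSucc_injective : Function.Injective (evenSucc : EvenField ι × ℕ → _) := by
  rintro ⟨φ, m⟩ ⟨φ', m'⟩ h
  simpa [evenSucc] using h

/-- The odd jet variable `∂_z w`. -/
def oddSucc (w : OddField ι × ℕ) : OddField ι × ℕ := (w.1, w.2 + 1)

theorem oddSucc_injective : Function.Injective (oddSucc : OddField ι × ℕ → _) := by
  rintro ⟨φ, m⟩ ⟨φ', m'⟩ h
  simpa [oddSucc] using h

/-- The summands of `∂_z` at the even variables. -/
def evenTerm (f : FieldSeries ι) (v : EvenField ι × ℕ) : FieldSeries ι :=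
  even (evenSucc v) * evenDeriv v f

/-- The summands of `∂_z` at the odd variables. -/
def oddTerm (f : FieldSeries ι) (w : OddField ι × ℕ) : FieldSeries ι :=
  odd (oddSucc w) * oddDeriv w f

theorem totalDeriv_eq (f : FieldSeries ι) :
    totalDeriv f = formalSum (evenTerm f) + formalSum (oddTerm f) := rfl

/-- The summand at `v` is divisible by `∂_z v`, so it reaches only monomials containing that
variable, whatever `f` is. -/
theorem finite_evenTerm (a : (EvenField ι × ℕ →₀ ℕ) × Finset (OddField ι × ℕ)) :
    {v | ∃ f : FieldSeries ι, evenTerm f v a ≠ 0}.Finite := by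
  refine (Set.Finite.preimage evenSucc_injective.injOn a.1.support.finite_toSet).subset ?_
  rintro v ⟨f, hf⟩
  simp only [Set.mem_preimage, Finset.mem_coe, Finsupp.mem_support_iff]
  exact fun h => hf (even_mul_apply_of_eq_zero _ _ h)

theorem finite_oddTerm (a : (EvenField ι × ℕ →₀ ℕ) × Finset (OddField ι × ℕ)) :
    {w | ∃ f : FieldSeries ι, oddTerm f w a ≠ 0}.Finite := by
  refine (Set.Finite.preimage oddSucc_injective.injOn a.2.finite_toSet).subset ?_
  rintro w ⟨f, hf⟩
  simp only [Set.mem_preimage, Finset.mem_coe]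
  by_contra h
  exact hf ((odd_mul_apply _ _ _ _).trans (if_neg h))

theorem rowFinite_evenTerm (v : EvenField ι × ℕ) : RowFinite fun f => evenTerm f v :=
  (rowFinite_mul_left _).comp (rowFinite_evenDeriv v)

theorem rowFinite_oddTerm (w : OddField ι × ℕ) : RowFinite fun f => oddTerm f w :=
  (rowFinite_mul_left _).comp (rowFinite_oddDeriv w)

theorem locallyFinite_evenTerm (f : FieldSeries ι) : LocallyFinite (evenTerm f) :=
  fun a => (finite_evenTerm a).subset fun _ h => ⟨f, h⟩

theorem locallyFinite_oddTerm (f : FieldSeries ι) : LocallyFinite (oddTerm f) :=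
  fun a => (finite_oddTerm a).subset fun _ h => ⟨f, h⟩

theorem rowFinite_totalDeriv : RowFinite (totalDeriv : FieldSeries ι → _) :=
  (rowFinite_formalSum rowFinite_evenTerm finite_evenTerm).add
    (rowFinite_formalSum rowFinite_oddTerm finite_oddTerm)

/-- The total derivative as a linear map. -/
def totalDerivLinear (ι : Type*) : FieldSeries ι →ₗ[ℂ] FieldSeries ι :=
  rowFinite_totalDeriv.isLinearMap.mk' _

@[simp] theorem totalDerivLinear_apply (f : FieldSeries ι) :
    totalDerivLinear ι f = totalDeriv f := rfl

theorem totalDeriv_mem (f : FieldSeries ι) : totalDeriv f ∈ totalDerivatives ι :=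
  Submodule.subset_span ⟨f, rfl⟩

/-- The range of the linear map `∂_z` is already a subspace, so the span adds nothing and a single
primitive `h` suffices. -/
theorem circleInt_eq_iff (f g : FieldSeries ι) :
    circleInt f = circleInt g ↔ ∃ h, f = g + totalDeriv h := by
  have : totalDerivatives ι = LinearMap.range (totalDerivLinear ι) := by
    refine le_antisymm (Submodule.span_le.mpr ?_) ?_
    · rintro _ ⟨f, rfl⟩
      exact ⟨f, rfl⟩
    · rintro _ ⟨f, rfl⟩
      exact totalDeriv_mem f
  rw [circleInt, circleInt, Submodule.Quotient.eq, this, LinearMap.mem_range]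
  simp only [totalDerivLinear_apply, eq_sub_iff_add_eq, eq_comm, add_comm]

/-! ### The jet weight -/

/-- The total number of derivatives in a monomial. -/
def jetWeight (a : (EvenField ι × ℕ →₀ ℕ) × Finset (OddField ι × ℕ)) : ℕ :=
  Finsupp.weight Prod.snd a.1 + ∑ w ∈ a.2, w.2

open Classical in
theorem sum_insert_erase_add {τ : Type*} (c : τ → ℕ) {S : Finset τ} {u w : τ} (hu : u ∈ S)
    (hw : w ∉ S.erase u) : ∑ x ∈ insert w (S.erase u), c x + c u = c w + ∑ x ∈ S, c x := by
  rw [Finset.sum_insert hw, add_assoc, Finset.sum_erase_add _ _ hu]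

/-- Each summand of `∂_z` trades one jet variable for the one with one more derivative, raising the
weight by exactly one. -/
theorem totalDeriv_eq_zero_of_jetWeight_lt {f : FieldSeries ι} {N : ℕ}
    (hf : ∀ a, jetWeight a < N → f a = 0) (a) (ha : jetWeight a < N + 1) :
    totalDeriv f a = 0 := by
  classical
  obtain ⟨n, S⟩ := a
  have he : ∀ v, evenTerm f v (n, S) = 0 := by
    intro v
    by_cases h : n (evenSucc v) = 0
    · exact even_mul_apply_of_eq_zero _ _ h
    · obtain ⟨n', rfl⟩ : ∃ n', n = n' + Finsupp.single (evenSucc v) 1 :=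
        ⟨n - Finsupp.single (evenSucc v) 1, (tsub_add_cancel_of_le (by
          simpa [Nat.one_le_iff_ne_zero] using h)).symm⟩
      rw [evenTerm, even_mul_apply_add, evenDeriv, hf _, mul_zero]
      simp only [jetWeight, map_add, Finsupp.weight_single, evenSucc, smul_eq_mul] at ha ⊢
      omega
  have ho : ∀ w, oddTerm f w (n, S) = 0 := by
    intro w
    rw [oddTerm, odd_mul_apply]
    split_ifs with h
    · rw [oddDeriv]
      split_ifs with h'
      · simp
      · rw [hf _]
        · simp
        · simp only [jetWeight] at ha ⊢
          have := sum_insert_erase_add Prod.snd h h'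
          rw [show (oddSucc w).2 = w.2 + 1 from rfl] at this
          omega
    · rfl
  rw [totalDeriv_eq, SuperSeries.add_apply]
  simp [formalSum, he, ho]

theorem iterate_eq_zero_of_jetWeight_lt {Φ : FieldSeries ι → FieldSeries ι}
    (hΦ : ∀ f N, (∀ a, jetWeight a < N → f a = 0) → ∀ a, jetWeight a < N + 1 → Φ f a = 0)
    (f : FieldSeries ι) (m : ℕ) (a) (ha : jetWeight a < m) : Φ^[m] f a = 0 := by
  induction m generalizing a with
  | zero => omega
  | succ m ih =>
    rw [Function.iterate_succ_apply']
    exact hΦ _ _ ih a ha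

theorem totalDeriv_iterate_eq_zero (f : FieldSeries ι) (m : ℕ) (a) (ha : jetWeight a < m) :
    totalDeriv^[m] f a = 0 :=
  iterate_eq_zero_of_jetWeight_lt (fun _ _ => totalDeriv_eq_zero_of_jetWeight_lt) f m a ha

theorem neg_totalDeriv_iterate_eq_zero (f : FieldSeries ι) (m : ℕ) (a) (ha : jetWeight a < m) :
    (fun h => -totalDeriv h)^[m] f a = 0 :=
  iterate_eq_zero_of_jetWeight_lt (fun f N hf a ha => by
    rw [neg_apply, totalDeriv_eq_zero_of_jetWeight_lt hf a ha, neg_zero]) f m a ha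

/-- A monomial of weight `N` is out of reach of `(-∂_z)^m` for `m > N`; hence no condition on the `g
m` is needed. -/
theorem locallyFinite_neg_iterate (g : ℕ → FieldSeries ι) :
    LocallyFinite fun m => (fun h => -totalDeriv h)^[m] (g m) := fun a =>
  (Set.finite_Iic (jetWeight a)).subset fun m hm => by
    by_contra h
    exact hm (neg_totalDeriv_iterate_eq_zero _ _ _ (by simpa using h))

/-! ### The Euler operator -/

open Classical in
theorem evenDeriv_evenTerm (u v : EvenField ι × ℕ) (f : FieldSeries ι) :
    evenDeriv u (evenTerm f v) =
      (if u = evenSucc v then evenDeriv v f else 0) + evenTerm (evenDeriv u f) v := by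
  rw [evenTerm, evenTerm, even_eq_ofEven, evenDeriv_ofEven_mul, evenDeriv_comm v u]
  congr 1
  refine ext_part fun S => ?_
  rw [part_ofEven_mul]
  split_ifs with h
  · rw [h, pderiv_X_self, one_mul]
  · rw [pderiv_X_of_ne (Ne.symm h), zero_mul]; rfl

theorem evenDeriv_formalSum_oddTerm (u : EvenField ι × ℕ) (f : FieldSeries ι) :
    evenDeriv u (formalSum (oddTerm f)) = formalSum (oddTerm (evenDeriv u f)) := by
  rw [(rowFinite_evenDeriv u).map_formalSum (locallyFinite_oddTerm f)]
  simp only [oddTerm, evenDeriv_odd_mul, evenDeriv_oddDeriv]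
  rfl

/-- An undifferentiated variable is not `∂_z` of any variable, so the commutator has no extra term.
-/
theorem evenDeriv_totalDeriv_zero (φ : EvenField ι) (f : FieldSeries ι) :
    evenDeriv (φ, 0) (totalDeriv f) = totalDeriv (evenDeriv (φ, 0) f) := by
  rw [totalDeriv_eq, (rowFinite_evenDeriv _).isLinearMap.map_add, evenDeriv_formalSum_oddTerm,
    (rowFinite_evenDeriv _).map_formalSum (locallyFinite_evenTerm f), totalDeriv_eq]
  congr 2
  ext1 v
  rw [evenDeriv_evenTerm, if_neg (by simp [evenSucc]), zero_add]

/-- The commutator of `∂/∂(∂_z^{m+1} φ)` with `∂_z` is `∂/∂(∂_z^m φ)`, coming from the single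
summand of `∂_z` that multiplies by `∂_z^{m+1} φ`. -/
theorem evenDeriv_totalDeriv_succ (φ : EvenField ι) (m : ℕ) (f : FieldSeries ι) :
    evenDeriv (φ, m + 1) (totalDeriv f) =
      evenDeriv (φ, m) f + totalDeriv (evenDeriv (φ, m + 1) f) := by
  classical
  have hs : ∀ v : EvenField ι × ℕ, (φ, m + 1) = evenSucc v ↔ v = (φ, m) := fun v =>
    ⟨fun h => (evenSucc_injective (a₁ := (φ, m)) h).symm, fun h => h ▸ rfl⟩
  rw [totalDeriv_eq, (rowFinite_evenDeriv _).isLinearMap.map_add, evenDeriv_formalSum_oddTerm,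
    (rowFinite_evenDeriv _).map_formalSum (locallyFinite_evenTerm f), totalDeriv_eq, ← add_assoc]
  congr 1
  simp only [evenDeriv_evenTerm, hs]
  rw [formalSum_add _ (locallyFinite_evenTerm _), formalSum_eq_single (φ, m), if_pos rfl]
  · intro v hv
    rw [if_neg hv]
  · intro a
    refine (Set.finite_singleton (φ, m)).subset fun v hv => ?_
    by_contra h
    exact hv (congrArg (coeffHom a) (if_neg (show v ≠ (φ, m) from h)))

theorem neg_totalDeriv_iterate_add (m : ℕ) (f g : FieldSeries ι) :
    (fun h => -totalDeriv h)^[m] (f + g) =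
      (fun h => -totalDeriv h)^[m] f + (fun h => -totalDeriv h)^[m] g :=
  iterate_map_add (-totalDerivLinear ι) m f g

theorem varEven_add (φ : EvenField ι) (f g : FieldSeries ι) :
    varEven φ (f + g) = varEven φ f + varEven φ g := by
  rw [varEven, varEven, varEven,
    ← formalSum_add (locallyFinite_neg_iterate _) (locallyFinite_neg_iterate _)]
  congr 1
  ext1 m
  rw [(rowFinite_evenDeriv _).isLinearMap.map_add, neg_totalDeriv_iterate_add]

theorem formalSum_telescope {t : ℕ → FieldSeries ι} (ht : LocallyFinite t) :
    formalSum (fun m => (if m = 0 then 0 else t (m - 1)) - t m) = 0 := by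
  ext a
  obtain ⟨N, hN⟩ := (ht a).bddAbove
  have hz : ∀ m, N < m → t m a = 0 := fun m hm => by
    by_contra h
    exact absurd (hN h) (by simpa using hm)
  simp only [formalSum]
  -- With `t` vanishing beyond `N`, the summands up to `N + 1` include the last nonzero one, and the
  -- telescoped boundary term is `t (N + 1) = 0`.
  rw [finsum_eq_sum_of_support_subset (s := Finset.range (N + 2)), Finset.sum_range_succ']
  · simp only [Nat.add_eq_zero_iff, one_ne_zero, and_false, if_false, if_true,
      Nat.add_sub_cancel, sub_apply, zero_apply, Finset.sum_range_sub', hz (N + 1) (by omega)]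
    ring
  · intro m hm
    by_contra h
    simp only [Finset.coe_range, Set.mem_Iio, not_lt] at h
    have h0 : m ≠ 0 := by omega
    refine hm ?_
    dsimp only
    simp only [if_neg h0, sub_apply]
    rw [hz m (by omega), hz (m - 1) (by omega), sub_zero]

theorem neg_totalDeriv_iterate_neg (m : ℕ) (f : FieldSeries ι) :
    (fun h => -totalDeriv h)^[m] (-f) = -(fun h => -totalDeriv h)^[m] f :=
  iterate_map_neg (-totalDerivLinear ι) m f

/-- With `t m = (-∂_z)^{m+1} ∂f/∂(∂_z^m φ)`, the commutator formula turns the `m`-th summand of the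
Euler operator into `t (m - 1) - t m`, and the sum telescopes. -/
theorem varEven_totalDeriv (φ : EvenField ι) (f : FieldSeries ι) :
    varEven φ (totalDeriv f) = 0 := by
  rw [← formalSum_telescope
    (locallyFinite_neg_iterate fun m => -totalDeriv (evenDeriv (φ, m) f)), varEven]
  congr 1
  ext1 m
  cases m with
  | zero => simp [evenDeriv_totalDeriv_zero]
  | succ m =>
    rw [evenDeriv_totalDeriv_succ, neg_totalDeriv_iterate_add, if_neg (Nat.succ_ne_zero m),
      neg_totalDeriv_iterate_neg (m + 1), sub_neg_eq_add, Function.iterate_succ_apply,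
      Nat.add_sub_cancel]

/-! ### Series in the even variables and the Leibniz rule -/

theorem totalDeriv_ofEven (P : MvPowerSeries (EvenField ι × ℕ) ℂ) :
    (totalDeriv (ofEven P) : FieldSeries ι) = formalSum (evenTerm (ofEven P)) := by
  rw [totalDeriv_eq, formalSum_eq_zero (f := oddTerm _), add_zero]
  intro w
  rw [oddTerm, oddDeriv_ofEven, mul_zero]

theorem exists_totalDeriv_ofEven (P : MvPowerSeries (EvenField ι × ℕ) ℂ) :
    ∃ Q, (totalDeriv (ofEven P) : FieldSeries ι) = ofEven Q := by
  refine ⟨part ∅ (totalDeriv (ofEven P) : FieldSeries ι), ext fun a => ?_⟩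
  obtain ⟨n, S⟩ := a
  by_cases h : S = ∅
  · subst h
    rw [ofEven_apply_empty, coeff_part]
  · rw [ofEven_apply_of_ne _ h, totalDeriv_ofEven]
    refine finsum_eq_zero_of_forall_eq_zero fun v => ?_
    rw [evenTerm, even_eq_ofEven, evenDeriv_ofEven, ← ofEven_mul, ofEven_apply_of_ne _ h]

theorem totalDeriv_ofEven_mul (P : MvPowerSeries (EvenField ι × ℕ) ℂ) (g : FieldSeries ι) :
    totalDeriv (ofEven P * g) = totalDeriv (ofEven P) * g + ofEven P * totalDeriv g := by
  have he : evenTerm (ofEven P * g) = fun v => evenTerm (ofEven P) v * g +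
      ofEven P * evenTerm g v := by
    ext1 v
    simp only [evenTerm, even_eq_ofEven, evenDeriv_ofEven_mul, mul_add, evenDeriv_ofEven,
      ofEven_mul_mul, ← ofEven_mul, mul_comm]
  have ho : oddTerm (ofEven P * g) = fun w => ofEven P * oddTerm g w := by
    ext1 w
    simp only [oddTerm, oddDeriv_ofEven_mul, odd_mul_ofEven_mul]
  have h1 := (rowFinite_mul_right g).map_formalSum (locallyFinite_evenTerm (ofEven P))
  have h2 := (rowFinite_mul_left (ofEven P)).map_formalSum (locallyFinite_evenTerm g)
  have h3 := (rowFinite_mul_left (ofEven P)).map_formalSum (locallyFinite_oddTerm g)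
  rw [totalDeriv_ofEven, totalDeriv_eq, totalDeriv_eq, he, ho, mul_add, h1, h2, h3, ← add_assoc,
    formalSum_add ((rowFinite_mul_right g).locallyFinite (locallyFinite_evenTerm _))
      ((rowFinite_mul_left _).locallyFinite (locallyFinite_evenTerm _))]

/-! ### Evolutionary vector fields -/

/-- The derivation with values `ξ v` on the even variables and zero on the odd variables. -/
def evenField (ξ : EvenField ι × ℕ → FieldSeries ι) (f : FieldSeries ι) : FieldSeries ι :=
  formalSum fun v => ξ v * evenDeriv v f

theorem evenField_add {ξ : EvenField ι × ℕ → FieldSeries ι}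
    (hfin : ∀ g : EvenField ι × ℕ → FieldSeries ι, LocallyFinite fun v => ξ v * g v)
    (f g : FieldSeries ι) : evenField ξ (f + g) = evenField ξ f + evenField ξ g := by
  rw [evenField, evenField, evenField, ← formalSum_add (hfin _) (hfin _)]
  simp only [(rowFinite_evenDeriv _).isLinearMap.map_add, mul_add]

/-- Two shifts cancel: moving `∂_z` past `∂/∂v` lowers the jet order, while applying `∂_z` to the
coefficient `ξ v` raises it. Evenness of `ξ v` makes the Leibniz rule available; `f` itself may
contain odd variables. -/
theorem totalDeriv_evenField {ξ : EvenField ι × ℕ → FieldSeries ι}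
    (hfin : ∀ g : EvenField ι × ℕ → FieldSeries ι, LocallyFinite fun v => ξ v * g v)
    (heven : ∀ v, ∃ P, ξ v = ofEven P) (hξ : ∀ v, ξ (evenSucc v) = totalDeriv (ξ v))
    (f : FieldSeries ι) : evenField ξ (totalDeriv f) = totalDeriv (evenField ξ f) := by
  classical
  have hL : ∀ v : EvenField ι × ℕ, evenDeriv v (totalDeriv f) =
      (if v.2 = 0 then 0 else evenDeriv (v.1, v.2 - 1) f) + totalDeriv (evenDeriv v f) := by
    rintro ⟨φ, _ | m⟩
    · rw [evenDeriv_totalDeriv_zero, if_pos rfl, zero_add]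
    · rw [evenDeriv_totalDeriv_succ, if_neg (Nat.succ_ne_zero m)]; rfl
  have hR : ∀ v, totalDeriv (ξ v * evenDeriv v f) =
      ξ (evenSucc v) * evenDeriv v f + ξ v * totalDeriv (evenDeriv v f) := by
    intro v
    rw [hξ]
    obtain ⟨P, hP⟩ := heven v
    rw [hP, totalDeriv_ofEven_mul]
  -- Reindexing along `v ↦ ∂_z v`. The undifferentiated variables missed by this map contribute zero
  -- because of the `if`.
  have hs : formalSum (fun v => ξ (evenSucc v) * evenDeriv v f) =
      formalSum fun v : EvenField ι × ℕ =>
        ξ v * (if v.2 = 0 then 0 else evenDeriv (v.1, v.2 - 1) f) := by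
    refine Eq.trans ?_ (formalSum_comp_embedding (f := fun v : EvenField ι × ℕ =>
      ξ v * (if v.2 = 0 then 0 else evenDeriv (v.1, v.2 - 1) f)) evenSucc_injective ?_)
    · simp [evenSucc]
    · rintro ⟨φ, _ | m⟩ h
      · simp
      · exact absurd ⟨(φ, m), rfl⟩ h
  have hfin' : LocallyFinite fun v => ξ (evenSucc v) * evenDeriv v f := by
    intro a
    refine (Set.Finite.preimage (evenSucc_injective (ι := ι)).injOn
      (hfin (fun v => evenDeriv (v.1, v.2 - 1) f) a)).subset fun v hv => ?_
    simpa [evenSucc] using hv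
  rw [evenField, evenField, rowFinite_totalDeriv.map_formalSum (hfin _)]
  simp only [hL, hR, mul_add]
  rw [formalSum_add (hfin _) (hfin _), formalSum_add hfin' (hfin _), hs]

end FieldSeries

/-! ### Currents and their variational derivatives -/

namespace FieldSeries

open SuperSeries EvenField OddField MvPowerSeries

variable {ι : Type*}

theorem Density.apply_eq_zero (L : Density ι) {a} {k : ℕ} {α : ι} {m : ℕ}
    (h : (lam1 k α, m) ∈ a.2) : (L : FieldSeries ι) a = 0 := by
  by_contra h0
  obtain ⟨k', α', h'⟩ := (L.2 a h0).2 _ h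
  cases h'

theorem Density.oddDeriv_eq_zero (L : Density ι) (k : ℕ) (α : ι) (m : ℕ) :
    oddDeriv (lam1 k α, m) (L : FieldSeries ι) = 0 :=
  SuperSeries.oddDeriv_eq_zero fun _ _ h => Density.apply_eq_zero L h

/-- Since `L` is free of `lam1`, the 2-form current is linear in `lam1`, with the `lam0`-derivatives
of `L` as coefficients. The `rho1` terms contain no `lam1`. -/
theorem oddDeriv_currentTwo (L : Density ι) (k : ℕ) (β : ι) (m : ℕ) :
    oddDeriv (lam1 k β, m) (currentTwo L) = evenDeriv (lam0 k β, m) (L : FieldSeries ι) := by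
  classical
  have hL : ∀ p T, (lam1 k β, m) ∈ T → (L : FieldSeries ι) (p, T) = 0 :=
    fun p T h => Density.apply_eq_zero L h
  ext ⟨n, U⟩
  rw [oddDeriv]
  split_ifs with h
  · rw [evenDeriv, hL _ _ h, mul_zero]
  · rw [currentTwo, derivation, SuperSeries.add_apply, formalSum, formalSum,
      finsum_eq_single _ (lam0 k β, m), finsum_eq_zero_of_forall_eq_zero, add_zero]
    · dsimp only
      -- The sign from extracting the odd variable on the left cancels the sign from inserting it
      -- there.
      rw [odd_mul_apply_insert _ _ h, ← mul_assoc, sign_mul_self, one_mul]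
    · rintro ⟨⟨k', α'⟩ | ⟨k', α'⟩, m'⟩
      · dsimp only
        rw [zero_mul]; rfl
      · exact even_mul_apply_eq_zero _ _ fun p =>
          oddDeriv_apply_eq_zero _ hL _ (by simp)
    · rintro ⟨⟨k', α'⟩ | ⟨k', α'⟩, m'⟩ hne
      · refine odd_mul_apply_eq_zero (w := (lam1 k β, m)) (fun h => hne ?_) (fun p T hT => ?_) _
          (by simp)
        · cases h
          rfl
        · rw [evenDeriv, hL _ _ hT, mul_zero]
      · dsimp only
        rw [zero_mul]; rfl

theorem varOdd_currentTwo (L : Density ι) (k : ℕ) (β : ι) :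
    varOdd (lam1 k β) (currentTwo L) = varEven (lam0 k β) (L : FieldSeries ι) := by
  simp only [varOdd, varEven, oddDeriv_currentTwo]

/-! ### Series in the undifferentiated `λ^β_0` -/

/-- The variables `λ^β_0` among the jets of the component fields. -/
def smallField (ι : Type*) : ι ↪ EvenField ι × ℕ :=
  ⟨fun β => (lam0 0 β, 0), fun _ _ h => by cases h; rfl⟩

@[simp] theorem smallField_apply (β : ι) : smallField ι β = (lam0 0 β, 0) := rfl

/-- A power series in variables indexed by `ι`, read as a series in the `λ^β_0`. -/
def ofSmall (f : MvPowerSeries ι ℂ) : FieldSeries ι := ofEven (rename (smallField ι) f)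

theorem pderiv_rename {σ σ' : Type*} (e : σ ↪ σ') (i : σ) (f : MvPowerSeries σ ℂ) :
    pderiv ℂ (e i) (rename e f) = rename e (pderiv ℂ i f) := by
  ext n
  by_cases h : n ∈ Set.range (Finsupp.embDomain e)
  · obtain ⟨n, rfl⟩ := h
    rw [coeff_pderiv, coeff_embDomain_rename, coeff_pderiv, ← Finsupp.embDomain_single,
      ← Finsupp.embDomain_add, coeff_embDomain_rename, Finsupp.embDomain_apply_self]
  · have h' : n + Finsupp.single (e i) 1 ∉ Set.range (Finsupp.embDomain e) := by
      simp only [Finsupp.mem_range_embDomain_iff] at h ⊢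
      refine fun h1 => h fun v hv => h1 ?_
      simp only [Finset.mem_coe, Finsupp.mem_support_iff, Finsupp.add_apply] at hv ⊢
      omega
    simp only [Set.mem_range, Finsupp.embDomain_eq_mapDomain] at h h'
    rw [coeff_pderiv, coeff_rename_eq_zero _ _ h, coeff_rename_eq_zero _ _ h', zero_mul]

theorem pderiv_rename_of_notMem {σ σ' : Type*} (e : σ ↪ σ') {v : σ'} (hv : v ∉ Set.range e)
    (f : MvPowerSeries σ ℂ) : pderiv ℂ v (rename e f) = 0 := by
  ext n
  rw [coeff_pderiv, coeff_rename_eq_zero, zero_mul, map_zero]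
  have h' : n + Finsupp.single v 1 ∉ Set.range (Finsupp.embDomain e) := by
    rw [Finsupp.mem_range_embDomain_iff]
    exact fun h => hv (h (by simp))
  simpa only [Set.mem_range, Finsupp.embDomain_eq_mapDomain] using h'

theorem evenDeriv_ofSmall (β : ι) (f : MvPowerSeries ι ℂ) :
    evenDeriv (lam0 0 β, 0) (ofSmall f) = ofSmall (pderiv ℂ β f) := by
  rw [ofSmall, evenDeriv_ofEven, ← smallField_apply, pderiv_rename, ofSmall]

theorem evenDeriv_ofSmall_of_notMem {v : EvenField ι × ℕ} (hv : v ∉ Set.range (smallField ι))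
    (f : MvPowerSeries ι ℂ) : evenDeriv v (ofSmall f) = 0 := by
  rw [ofSmall, evenDeriv_ofEven, pderiv_rename_of_notMem _ hv]
  ext a
  simp [ofEven]

/-- The chain rule: a function of the undifferentiated fields has a total derivative linear in their
first jets. -/
theorem totalDeriv_ofSmall [Fintype ι] (f : MvPowerSeries ι ℂ) :
    totalDeriv (ofSmall f) =
      ofEven (∑ γ, X (lam0 0 γ, 1) * rename (smallField ι) (pderiv ℂ γ f)) := by
  rw [ofSmall, totalDeriv_ofEven, ← ofSmall, formalSum_eq_sum_comp (smallField ι).injective]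
  · simp only [evenTerm, smallField_apply, evenDeriv_ofSmall, ofEven_sum, ofEven_mul,
      ← even_eq_ofEven]
    rfl
  · intro v hv
    rw [evenTerm, evenDeriv_ofSmall_of_notMem hv, mul_zero]

theorem varEven_ofSmall (β : ι) (f : MvPowerSeries ι ℂ) :
    varEven (lam0 0 β) (ofSmall f) = ofSmall (pderiv ℂ β f) := by
  rw [varEven, formalSum_eq_single 0, Function.iterate_zero_apply, evenDeriv_ofSmall]
  intro m hm
  rw [evenDeriv_ofSmall_of_notMem]
  · exact iterate_map_zero (-totalDerivLinear ι) m
  · rintro ⟨γ, h⟩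
    simp only [smallField_apply, Prod.mk.injEq] at h
    exact hm h.2.symm

/-! ### The Hamiltonian vector field as an evolutionary field -/

/-- The values on the even variables of the evolutionary vector field `λ^α_0 ↦ ζ α`. -/
def evolution (ζ : ι → FieldSeries ι) (v : EvenField ι × ℕ) : FieldSeries ι :=
  match v with
  | (lam0 0 α, m) => totalDeriv^[m] (ζ α)
  | _ => 0

theorem evolution_evenSucc (ζ : ι → FieldSeries ι) (v : EvenField ι × ℕ) :
    evolution ζ (evenSucc v) = totalDeriv (evolution ζ v) := by
  obtain ⟨⟨_ | k, α⟩ | ⟨k, α⟩, m⟩ := v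
  · exact Function.iterate_succ_apply' _ _ _
  · exact (totalDerivLinear ι).map_zero.symm
  · exact (totalDerivLinear ι).map_zero.symm

theorem exists_ofEven_evolution {ζ : ι → FieldSeries ι} (hζ : ∀ α, ∃ P, ζ α = ofEven P)
    (v : EvenField ι × ℕ) : ∃ P, evolution ζ v = ofEven P := by
  have h0 : ∃ P, (0 : FieldSeries ι) = ofEven P := ⟨0, by ext a; simp [ofEven]⟩
  obtain ⟨⟨_ | k, α⟩ | ⟨k, α⟩, m⟩ := v
  · induction m with
    | zero => exact hζ α
    | succ m ih =>
      obtain ⟨P, hP⟩ := ih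
      obtain ⟨Q, hQ⟩ := exists_totalDeriv_ofEven (ι := ι) P
      exact ⟨Q, by rw [← hQ, ← hP]; exact evolution_evenSucc ζ (lam0 0 α, m)⟩
  · exact h0
  · exact h0

theorem evolution_apply_eq_zero {ζ : ι → FieldSeries ι} (v : EvenField ι × ℕ) (a)
    (ha : jetWeight a < v.2) : evolution ζ v a = 0 := by
  obtain ⟨⟨_ | k, α⟩ | ⟨k, α⟩, m⟩ := v
  · exact totalDeriv_iterate_eq_zero _ _ _ ha
  · rfl
  · rfl

variable [Fintype ι]

/-- For a fixed monomial, its weight bounds the jet order `m`, and finiteness of `ι` bounds the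
remaining index. -/
theorem locallyFinite_evolution_mul (ζ : ι → FieldSeries ι) (g : EvenField ι × ℕ → FieldSeries ι) :
    LocallyFinite fun v => evolution ζ v * g v := by
  classical
  intro a
  refine ((Set.finite_range fun p : ι × Fin (jetWeight a + 1) =>
    ((lam0 0 p.1, p.2) : EvenField ι × ℕ))).subset fun v hv => ?_
  by_contra h
  refine hv ?_
  have h0 : evolution ζ v = 0 ∨ jetWeight a < v.2 := by
    obtain ⟨⟨_ | k, α⟩ | ⟨k, α⟩, m⟩ := v
    · right
      by_contra hm
      exact h ⟨(α, ⟨m, by dsimp only at hm; omega⟩), rfl⟩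
    · exact Or.inl rfl
    · exact Or.inl rfl
  rcases h0 with h0 | h0
  · dsimp only
    rw [h0, zero_mul]; rfl
  · change (evolution ζ v * g v : FieldSeries ι) a = 0
    refine mul_apply_eq_zero _ fun p q T hp hT => evolution_apply_eq_zero _ _ (lt_of_le_of_lt ?_ h0)
    rw [jetWeight, jetWeight, ← hp, map_add]
    have := Finset.sum_le_sum_of_subset (f := Prod.snd) hT
    dsimp only
    omega

theorem evenField_evolution_ofSmall (ζ : ι → FieldSeries ι) (f : MvPowerSeries ι ℂ) :
    evenField (evolution ζ) (ofSmall f) = ∑ α, ζ α * ofSmall (pderiv ℂ α f) := by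
  rw [evenField, formalSum_eq_sum_comp (smallField ι).injective]
  · simp only [smallField_apply, evenDeriv_ofSmall]
    rfl
  · intro v hv
    rw [evenDeriv_ofSmall_of_notMem hv, mul_zero]

/-- The odd half of the Hamiltonian field moves only the `lam1`, which a density does not contain.
-/
theorem hamiltonianField_density (ginv : Matrix ι ι ℂ) (s : FieldSeries ι) (L : Density ι) :
    hamiltonianField ginv s L =
      evenField (evolution fun α => -∑ β, ginv α β • totalDeriv (varOdd (lam1 0 β) s)) L := by
  rw [hamiltonianField, derivation, formalSum_eq_zero (κ := OddField ι × ℕ), add_zero]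
  · rfl
  · rintro ⟨⟨_ | k, α⟩ | ⟨k, α⟩, m⟩
    · rw [Density.oddDeriv_eq_zero, mul_zero]
    · exact zero_mul _
    · exact zero_mul _

/-- If the Hessians of `f₁` and the gradient of `f₂` contract to the differential of `w`, then all
currents equivalent to those of `f₁` and `f₂` have vanishing bracket. -/
theorem currentBracket_eq_zero (ginv : Matrix ι ι ℂ) (f₁ f₂ w : MvPowerSeries ι ℂ)
    (hw : ∀ γ, pderiv ℂ γ w =
      ∑ α, ∑ β, ginv α β • (pderiv ℂ γ (pderiv ℂ β f₁) * pderiv ℂ α f₂))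
    (L₁ L₂ : Density ι) (h₁ : circleInt (L₁ : FieldSeries ι) = circleInt (ofSmall f₁))
    (h₂ : circleInt (L₂ : FieldSeries ι) = circleInt (ofSmall f₂)) :
    currentBracket ginv L₁ L₂ = 0 := by
  -- The primitives `r₁`, `r₂` are arbitrary series and may involve `lam1`. Hence the passage to
  -- `varEven` and to the even half of the field is made on `L₁` and `L₂` before these are
  -- decomposed.
  obtain ⟨r₁, hr₁⟩ := (circleInt_eq_iff _ _).mp h₁
  obtain ⟨r₂, hr₂⟩ := (circleInt_eq_iff _ _).mp h₂
  have hvar : ∀ β, varOdd (lam1 0 β) (currentTwo L₁) = ofSmall (pderiv ℂ β f₁) := by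
    intro β
    rw [varOdd_currentTwo, hr₁, varEven_add, varEven_totalDeriv, add_zero, varEven_ofSmall]
  have hζ : ∀ α, (-∑ β, ginv α β • totalDeriv (ofSmall (pderiv ℂ β f₁)) : FieldSeries ι) =
      ofEven (-∑ β, ginv α β • ∑ γ, X (lam0 0 γ, 1) *
        rename (smallField ι) (pderiv ℂ γ (pderiv ℂ β f₁))) := by
    intro α
    simp only [totalDeriv_ofSmall, ofEven_neg, ofEven_sum, ofEven_smul]
  -- The sign is that of the BV vector field: the primitive is `-w`.
  have hmain : evenField (evolution fun α => -∑ β, ginv α β • totalDeriv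
      (ofSmall (pderiv ℂ β f₁))) (ofSmall f₂) = totalDeriv (ofSmall (-w)) := by
    rw [evenField_evolution_ofSmall, totalDeriv_ofSmall]
    simp only [hζ]
    simp only [ofSmall, ← ofEven_mul, ← ofEven_sum]
    congr 1
    simp only [map_neg, hw, map_sum, map_mul, map_smul, Finset.mul_sum, Finset.sum_mul, neg_mul,
      mul_neg, Finset.sum_neg_distrib, Finset.smul_sum, smul_mul_assoc, mul_smul_comm, mul_assoc]
    congr 1
    refine Eq.trans ?_ Finset.sum_comm
    exact Finset.sum_congr rfl fun α _ => Finset.sum_comm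
  rw [currentBracket, bvBracket, currentOne, hamiltonianField_density]
  simp only [hvar]
  rw [hr₂, evenField_add (locallyFinite_evolution_mul _), hmain,
    totalDeriv_evenField (locallyFinite_evolution_mul _) (exists_ofEven_evolution fun α => ⟨_, hζ α⟩)
      (evolution_evenSucc _)]
  exact (Submodule.Quotient.mk_eq_zero _).mpr
    (Submodule.add_mem _ (totalDeriv_mem _) (totalDeriv_mem _))

end FieldSeries

/-! ### Correlation functions on the small phase space -/

namespace CorrelationData

open FieldSeries EvenField SuperSeries MvPowerSeries

variable {ι H κ : Type*} [AddCommGroup H] [Module ℂ H] (T : CorrelationData ι H)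

theorem toDensity_eq_ofSmall [Fintype ι] (f : MvPowerSeries ι ℂ) :
    (toDensity f : FieldSeries ι) = ofSmall f := by
  classical
  ext ⟨n, S⟩
  change (if _ then _ else _) = _
  by_cases hS : S = ∅
  · subst hS
    rw [ofSmall, ofEven_apply_empty]
    by_cases h : ∀ v ∈ n.support, ∃ β, v = (lam0 0 β, 0)
    · rw [if_pos ⟨rfl, h⟩]
      obtain ⟨n', rfl⟩ : n ∈ Set.range (Finsupp.embDomain (smallField ι)) := by
        rw [Finsupp.mem_range_embDomain_iff]
        intro v hv
        obtain ⟨β, rfl⟩ := h v hv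
        exact ⟨β, rfl⟩
      rw [coeff_embDomain_rename]
      congr 2
      ext β
      exact Finsupp.embDomain_apply_self (smallField ι) n' β
    · rw [if_neg fun h' => h h'.2, coeff_rename_eq_zero]
      rintro ⟨n', hn'⟩
      rw [← Finsupp.embDomain_eq_mapDomain] at hn'
      have h'' := (Finsupp.mem_range_embDomain_iff _ _).mp ⟨n', hn'⟩
      refine h fun v hv => ?_
      obtain ⟨β, hβ⟩ := h'' hv
      exact ⟨β, hβ.symm⟩
  · rw [if_neg fun h => hS h.1, ofSmall, ofEven_apply_of_ne _ hS]

/-- Differentiating the exponential brings down one insertion; on coefficients, the factor `n v + 1`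
cancels against the factorial. -/
theorem pderiv_expCorr (u : κ → SymmetricAlgebra ℂ (ℕ → H)) (x : SymmetricAlgebra ℂ (ℕ → H))
    (v : κ) : pderiv ℂ v (T.expCorr u x) = T.expCorr u (x * u v) := by
  classical
  ext n
  rw [coeff_pderiv]
  change T.corr _ / _ * _ = T.corr _ / _
  have h1 : ((n + Finsupp.single v 1).prod fun v e => u v ^ e) =
      u v * n.prod fun v e => u v ^ e := by
    rw [Finsupp.prod_add_index' (by simp) (by simp [pow_add]), Finsupp.prod_single_index (by simp),
      pow_one, mul_comm]
  have h2 : ((n + Finsupp.single v 1).prod fun _ e => (e.factorial : ℂ)) =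
      (n v + 1) * n.prod fun _ e => (e.factorial : ℂ) := by
    rw [← Finsupp.mul_prod_erase' _ v _ (by simp), ← Finsupp.mul_prod_erase' n v _ (by simp),
      Finsupp.erase_add, Finsupp.erase_single, add_zero, Finsupp.add_apply, Finsupp.single_eq_same,
      Nat.factorial_succ]
    push_cast
    ring
  rw [h1, h2, mul_assoc]
  have h3 : (n v + 1 : ℂ) ≠ 0 := Nat.cast_add_one_ne_zero _
  field_simp

theorem expCorr_sum_smul {κ' : Type*} (u : κ → SymmetricAlgebra ℂ (ℕ → H)) (s : Finset κ')
    (c : κ' → ℂ) (x : κ' → SymmetricAlgebra ℂ (ℕ → H)) :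
    T.expCorr u (∑ i ∈ s, c i • x i) = ∑ i ∈ s, c i • T.expCorr u (x i) := by
  ext n
  simp only [map_sum]
  change T.corr _ / _ = ∑ i ∈ s, c i * (T.corr _ / _)
  simp only [Finset.sum_mul, map_sum, Finset.sum_div, smul_mul_assoc, map_smul, smul_eq_mul,
    mul_div_assoc]

/-- Setting the sources outside the image of `e` to zero leaves the exponential of the remaining
insertions. -/
theorem killCompl_expCorr {κ' : Type*} (e : κ ↪ κ') (u : κ' → SymmetricAlgebra ℂ (ℕ → H))
    (x : SymmetricAlgebra ℂ (ℕ → H)) :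
    killCompl e (T.expCorr u x) = T.expCorr (fun i => u (e i)) x := by
  ext n
  rw [coeff_killCompl]
  change T.corr _ / _ = T.corr _ / _
  rw [Finsupp.prod_embDomain, Finsupp.prod_embDomain]

variable [Fintype ι]

theorem metricInv_comm (α β : ι) : T.metricInv α β = T.metricInv β α := by
  classical
  have h : T.metric.IsSymm := by
    ext α β
    simp only [metric, Matrix.transpose_apply, Matrix.of_apply, mul_comm]
  have := h.inv.apply β α
  rw [metricInv]
  convert this

/-- The topological recursion relation on the small phase space. -/
theorem IsGenusZero.small_recursion (hT : T.IsGenusZero) (i j k : ℕ) (α β γ : ι) :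
    T.expCorr (T.insertion 0) (T.insertion (i + 1) α * T.insertion j β * T.insertion k γ) =
      ∑ σ, T.expCorr (T.insertion 0) (T.insertion i α * T.raisedInsertion 0 σ) *
        T.expCorr (T.insertion 0) (T.insertion 0 σ * T.insertion j β * T.insertion k γ) := by
  -- The small phase space sits at level zero. Killing all `b^α_k` with `k > 0` is a ring
  -- homomorphism, so it preserves the quadratic recursion.
  let e : ι ↪ ℕ × ι := ⟨fun β => (0, β), fun _ _ h => by cases h; rfl⟩
  have h : ∀ x, killCompl e (T.bigCorr x) = T.expCorr (T.insertion 0) x :=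
    fun x => T.killCompl_expCorr e _ x
  have := congrArg (killCompl e) (hT.recursion i j k α β γ)
  simpa only [map_sum, map_mul, h] using this

/-- This is the recursion relation for `O_β^{(m+1)}`, `O_α^{(k)}` and `O_γ^{(0)}`: the insertion
`O_γ` is the derivative, and the two factors on the right are a gradient and a Hessian of one-point
functions. -/
theorem pderiv_small_two_point (hT : T.IsGenusZero) (k m : ℕ) (α β γ : ι) :
    pderiv ℂ γ (T.expCorr (T.insertion 0) (T.insertion (m + 1) β * T.insertion k α)) =
      ∑ σ, ∑ τ, T.metricInv σ τ •
        (pderiv ℂ γ (pderiv ℂ τ (T.expCorr (T.insertion 0) (T.insertion k α))) *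
          pderiv ℂ σ (T.expCorr (T.insertion 0) (T.insertion m β))) := by
  simp only [pderiv_expCorr]
  rw [hT.small_recursion, Finset.sum_comm]
  refine Finset.sum_congr rfl fun σ _ => ?_
  simp only [raisedInsertion, Finset.mul_sum, mul_smul_comm, expCorr_sum_smul, Finset.sum_mul,
    smul_mul_assoc]
  refine Finset.sum_congr rfl fun τ _ => ?_
  rw [T.metricInv_comm, mul_comm (T.insertion 0 σ), mul_comm (T.expCorr _ _)]

end CorrelationData

theorem mainTheorem6 {ι H : Type*} [Fintype ι] [AddCommGroup H] [Module ℂ H]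
    (T : CorrelationData ι H) (hT : T.IsGenusZero) (k m : ℕ) (α β : ι)
    (L₁ L₂ : FieldSeries.Density ι)
    (h₁ : FieldSeries.circleInt (FieldSeries.currentOne L₁) =
      FieldSeries.circleInt (FieldSeries.currentOne (T.hamiltonianDensity k α)))
    (h₂ : FieldSeries.circleInt (FieldSeries.currentOne L₂) =
      FieldSeries.circleInt (FieldSeries.currentOne (T.hamiltonianDensity m β))) :
    FieldSeries.currentBracket T.metricInv L₁ L₂ = 0 := by
  simp only [FieldSeries.currentOne, CorrelationData.hamiltonianDensity,
    CorrelationData.toDensity_eq_ofSmall] at h₁ h₂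
  -- The potential `w`, left to unification, is the two-point function of `O_β^{(m+1)}` and
  -- `O_α^{(k)}`.
  exact FieldSeries.currentBracket_eq_zero _ _ _ _
    (T.pderiv_small_two_point hT k m α β) L₁ L₂ h₁ h₂

end
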